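/- Let $\mathbf{M}$ be a complete and cocomplete closed symmetric monoidal category which is additive. Let $\overline{\mathbf{C}}=(\mathbf{C},\perp)$ be an orthogonal category, i.e. a small category $\mathbf{C}$ with a symmetric relation $f_1\perp f_2$ on pairs of morphisms with common target such that $f_1\perp f_2$ implies $g f_1 h_1\perp g f_2 h_2$ for all composable $g,h_1,h_2$. A unital Lie algebra in $\mathbf{M}$ is an object $V$ with a bracket $[\cdot,\cdot]:V\otimes V\to V$ that is antisymmetric and satisfies the Jacobi identity, and a unit $\eta:I\to V$ with $[\cdot,\eta]=0$. Let $\mathbf{LFT}(\overline{\mathbf{C}})$ (linear field theories) be the full subcategory of the category of functors $\mathfrak{L}$ from $\mathbf{C}$ to unital Lie algebras in $\mathbf{M}$ on those with $[\cdot,\cdot]_c\,(\mathfrak{L}(f_1)\otimes\mathfrak{L}(f_2))=0$ for all $(f_1:c_1\to c)\perp(f_2:c_2\to c)$. Let $\mathbf{QFT}(\overline{\mathbf{C}})$ (quantum field theories) be the full subcategory of the category of functors $\mathfrak{A}$ from $\mathbf{C}$ to associative unital algebras in $\mathbf{M}$ on those with $(\mu_c-\mu_c^{\mathrm{op}})\,(\mathfrak{A}(f_1)\otimes\mathfrak{A}(f_2))=0$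 for all such $f_1\perp f_2$. Let $\mathfrak{U}_{\mathrm{lin}}:\mathbf{QFT}(\overline{\mathbf{C}})\to\mathbf{LFT}(\overline{\mathbf{C}})$ be the functor that applies $(A,\mu,\eta)\mapsto(A,\mu-\mu^{\mathrm{op}},\eta)$ objectwise. For a full subcategory $j:\mathbf{B}\to\mathbf{C}$ with the restricted orthogonality relation (a full orthogonal subcategory $j:\overline{\mathbf{B}}\to\overline{\mathbf{C}}$), let $j^*$ denote restriction of (linear, or quantum) field theories from $\overline{\mathbf{C}}$ to $\overline{\mathbf{B}}$, and $j_!$ its left adjoint. A field theory $\mathfrak{A}$ on $\overline{\mathbf{C}}$ is $j$-local (descent) if the counit $j_!\,j^*\mathfrak{A}\to\mathfrak{A}$ is an isomorphism. For a set $W$ of morphisms of $\mathbf{C}$, a field theory $\mathfrak{A}$ is $W$-constant (time-slice axiom) if $\mathfrak{A}(f)$ is an isomorphism for every $f\in W$. Then $\mathfrak{U}_{\mathrm{lin}}$ has a left adjoint, the linear quantization functor $\mathfrak{Q}_{\mathrm{lin}}:\mathbf{LFT}(\overline{\mathbf{C}})\to\mathbf{QFT}(\overline{\mathbf{C}})$,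 and (a) for every full orthogonal subcategory $j:\overline{\mathbf{B}}\to\overline{\mathbf{C}}$, $\mathfrak{Q}_{\mathrm{lin}}$ maps $j$-local linear field theories to $j$-local quantum field theories; (b) for every set $W$ of morphisms of $\mathbf{C}$, $\mathfrak{Q}_{\mathrm{lin}}$ maps $W$-constant linear field theories to $W$-constant quantum field theories. -/

import Mathlib

universe v u

open CategoryTheory MonoidalCategory Limits

namespace FieldTheory

/-! ### Orthogonal categories -/

section Orthogonal

/-- An orthogonality relation on a category: a symmetric relation on pairs of morphisms with a
common target which is stable under post- and precomposition. A category together with such a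
relation is an orthogonal category. -/
structure OrthogonalityRelation (C : Type v) [SmallCategory C] where
  /-- `Rel f₁ f₂` is the relation `f₁ ⊥ f₂`. -/
  Rel : ∀ ⦃c₁ c₂ c : C⦄, (c₁ ⟶ c) → (c₂ ⟶ c) → Prop
  symm : ∀ ⦃c₁ c₂ c : C⦄ (f₁ : c₁ ⟶ c) (f₂ : c₂ ⟶ c), Rel f₁ f₂ → Rel f₂ f₁
  comp : ∀ ⦃b₁ b₂ c₁ c₂ c d : C⦄ (g : c ⟶ d) (f₁ : c₁ ⟶ c) (f₂ : c₂ ⟶ c)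
    (h₁ : b₁ ⟶ c₁) (h₂ : b₂ ⟶ c₂), Rel f₁ f₂ → Rel (h₁ ≫ f₁ ≫ g) (h₂ ≫ f₂ ≫ g)

/-- The pullback orthogonality relation on a full subcategory. The category `P.FullSubcategory`
with this relation, and the inclusion `j = P.ι`, form a full orthogonal subcategory. -/
def OrthogonalityRelation.restrict {D : Type v} [SmallCategory D] (perp : OrthogonalityRelation D)
    (P : ObjectProperty D) : OrthogonalityRelation P.FullSubcategory where
  Rel _ _ _ f₁ f₂ := perp.Rel (P.ι.map f₁) (P.ι.map f₂)
  symm _ _ _ _ _ h := perp.symm _ _ h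
  comp _ _ _ _ _ _ g f₁ f₂ h₁ h₂ h := by
    simpa only [Functor.map_comp] using
      perp.comp (P.ι.map g) (P.ι.map f₁) (P.ι.map f₂) (P.ι.map h₁) (P.ι.map h₂) h

end Orthogonal

/-! ### Unital Lie algebras and the commutator functor -/

/-- In a closed symmetric monoidal additive category the monoidal product of morphisms is
biadditive, because the functors `X ⊗ -` preserve finite coproducts. -/
instance monoidalPreadditive (M : Type u) [Category.{v} M] [MonoidalCategory M]
    [SymmetricCategory M] [MonoidalClosed M] [Preadditive M] [HasFiniteCoproducts M] :
    MonoidalPreadditive M := by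
  have : HasFiniteBiproducts M := HasFiniteBiproducts.of_hasFiniteCoproducts
  have hadd (X : M) : (tensorLeft X).Additive := by
    have : PreservesColimitsOfSize.{0, 0} (tensorLeft X) :=
      (Closed.adj (X := X)).leftAdjoint_preservesColimits
    have : HasBinaryBiproducts M := hasBinaryBiproducts_of_finite_biproducts M
    have := preservesBinaryBiproducts_of_preservesBinaryCoproducts (tensorLeft X)
    exact Functor.additive_of_preservesBinaryBiproducts _
  have h0 (X : M) {Y Z : M} : X ◁ (0 : Y ⟶ Z) = 0 := (tensorLeft X).map_zero Y Z
  have h1 (X : M) {Y Z : M} (f g : Y ⟶ Z) : X ◁ (f + g) = X ◁ f + X ◁ g :=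
    (tensorLeft X).map_add
  have hr (X : M) {Y Z : M} (f : Y ⟶ Z) : f ▷ X = (β_ Y X).hom ≫ X ◁ f ≫ (β_ X Z).hom := by
    simp
  exact
    { whiskerLeft_zero := h0 _
      whiskerLeft_add := h1 _
      zero_whiskerRight := by intro X Y Z; rw [hr, h0]; simp
      add_whiskerRight := by intro X Y Z f g; rw [hr, hr, hr, h1]; simp }

section Lie

variable {M : Type u} [Category.{v} M] [MonoidalCategory M] [SymmetricCategory M]

/-- The cyclic permutation `x ⊗ (y ⊗ z) ↦ y ⊗ (z ⊗ x)`. -/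
def cyc (X : M) : X ⊗ (X ⊗ X) ⟶ X ⊗ (X ⊗ X) :=
  (β_ X (X ⊗ X)).hom ≫ (α_ X X X).hom

lemma cyc_cyc (X : M) : cyc X ≫ cyc X = X ◁ (β_ X X).hom ≫ (α_ X X X).inv ≫
    (β_ X X).hom ▷ X ≫ (α_ X X X).hom := by
  have h := BraidedCategory.yang_baxter X X X =≫ (X ◁ (β_ X X).hom)
  simp only [Category.assoc, ← MonoidalCategory.whiskerLeft_comp, SymmetricCategory.symmetry,
    MonoidalCategory.whiskerLeft_id, Category.comp_id] at h
  simpa [cyc, BraidedCategory.braiding_tensor_right_hom] using h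

lemma cyc_cyc_cyc (X : M) : cyc X ≫ cyc X ≫ cyc X = 𝟙 _ := by
  rw [← Category.assoc, cyc_cyc]
  simp only [cyc, BraidedCategory.braiding_tensor_right_hom, Category.assoc,
    Iso.hom_inv_id_assoc, Iso.inv_hom_id, Category.comp_id]
  rw [← comp_whiskerRight_assoc]
  simp [← MonoidalCategory.whiskerLeft_comp]

lemma whiskerLeft_braiding_cyc (X : M) :
    X ◁ (β_ X X).hom ≫ cyc X = cyc X ≫ cyc X ≫ X ◁ (β_ X X).hom := by
  rw [← Category.assoc (cyc X), cyc_cyc]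
  simp [cyc, BraidedCategory.braiding_tensor_right_hom]

variable (M) [Preadditive M]

/-- Unital Lie algebras in `M`: the algebras over the unital Lie operad, which is presented by a
binary bracket and a nullary unit `η`, with antisymmetry, the Jacobi identity
`[x, [y, z]] + [y, [z, x]] + [z, [x, y]] = 0`, and `[x, η] = 0`. -/
structure ULie where
  /-- the underlying object -/
  X : M
  /-- the Lie bracket -/
  bracket : X ⊗ X ⟶ X
  /-- the unit -/
  unit : 𝟙_ M ⟶ X
  antisymm : (β_ X X).hom ≫ bracket = -bracket
  jacobi : X ◁ bracket ≫ bracket + cyc X ≫ X ◁ bracket ≫ bracket +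
    cyc X ≫ cyc X ≫ X ◁ bracket ≫ bracket = 0
  bracket_unit : X ◁ unit ≫ bracket = 0

variable {M}

namespace ULie

/-- Morphisms of unital Lie algebras preserve the bracket and the unit. -/
@[ext]
structure Hom (V W : ULie M) where
  /-- the underlying morphism -/
  hom : V.X ⟶ W.X
  bracket_hom : V.bracket ≫ hom = (hom ⊗ₘ hom) ≫ W.bracket
  unit_hom : V.unit ≫ hom = W.unit

instance : Category (ULie M) where
  Hom V W := Hom V W
  id V := ⟨𝟙 V.X, by simp, by simp⟩
  comp f g := ⟨f.hom ≫ g.hom,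
    by rw [← Category.assoc, f.bracket_hom, Category.assoc, g.bracket_hom,
      ← Category.assoc, tensorHom_comp_tensorHom],
    by rw [← Category.assoc, f.unit_hom, g.unit_hom]⟩
  id_comp f := Hom.ext (Category.id_comp f.hom)
  comp_id f := Hom.ext (Category.comp_id f.hom)
  assoc f g h := Hom.ext (Category.assoc f.hom g.hom h.hom)

end ULie

/-- The commutator `μ - μᵒᵖ` of an associative and unital algebra (monoid object). -/
def commutator (A : Mon M) : A.X ⊗ A.X ⟶ A.X :=
  MonObj.mul - (β_ A.X A.X).hom ≫ MonObj.mul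

lemma commutator_antisymm (A : Mon M) : (β_ A.X A.X).hom ≫ commutator A = -commutator A := by
  simp [commutator]

lemma commutator_hom {A B : Mon M} (f : A ⟶ B) :
    commutator A ≫ f.hom = (f.hom ⊗ₘ f.hom) ≫ commutator B := by
  simp [commutator]

lemma commutator_jacobi [MonoidalPreadditive M] (A : Mon M) :
    A.X ◁ commutator A ≫ commutator A + cyc A.X ≫ A.X ◁ commutator A ≫ commutator A +
      cyc A.X ≫ cyc A.X ≫ A.X ◁ commutator A ≫ commutator A = 0 := by
  set σ := cyc A.X with hσ
  set s := A.X ◁ (β_ A.X A.X).hom with hs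
  set m := A.X ◁ (MonObj.mul (X := A.X)) ≫ MonObj.mul with hm
  have e₁ : A.X ◁ (MonObj.mul (X := A.X)) ≫ (β_ A.X A.X).hom ≫ MonObj.mul = σ ≫ m := by
    simp [hσ, hm, cyc, MonObj.mul_assoc]
  have hsub (f g : A.X ⊗ A.X ⟶ A.X) : A.X ◁ (f - g) = A.X ◁ f - A.X ◁ g :=
    (tensorLeft A.X).map_sub
  have e : A.X ◁ commutator A ≫ commutator A = m - s ≫ m - σ ≫ m + s ≫ σ ≫ m := by
    simp only [commutator, hsub, MonoidalCategory.whiskerLeft_comp,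
      Preadditive.sub_comp, Preadditive.comp_sub, Category.assoc, e₁]
    abel
  have h₃ : σ ≫ σ ≫ σ ≫ m = m := by
    have := cyc_cyc_cyc A.X =≫ m
    simpa using this
  have h₂ : s ≫ σ ≫ m = σ ≫ σ ≫ s ≫ m := by
    have := whiskerLeft_braiding_cyc A.X =≫ m
    simpa using this
  have h₄ : σ ≫ σ ≫ σ ≫ s ≫ m = s ≫ m := by
    have := cyc_cyc_cyc A.X =≫ (s ≫ m)
    simpa using this
  rw [e]
  simp only [Preadditive.comp_add, Preadditive.comp_sub, h₂, h₃, h₄]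
  abel

lemma commutator_one (A : Mon M) : A.X ◁ MonObj.one ≫ commutator A = 0 := by
  simp [commutator]

variable (M) in
/-- The functor `φ^*` from associative and unital algebras to unital Lie algebras which sends
`(A, μ, η)` to `(A, μ - μᵒᵖ, η)`. It is the pullback along the operad morphism
`φ : uLie ⟶ As` with `[·,·] ↦ μ - μᵒᵖ` and `η ↦ η`. -/
def commutatorFunctor [MonoidalPreadditive M] : Mon M ⥤ ULie M where
  obj A := 
    { X := A.X
      bracket := commutator A
      unit := MonObj.one
      antisymm := commutator_antisymm A
      jacobi := commutator_jacobi A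
      bracket_unit := commutator_one A }
  map f := ⟨f.hom, commutator_hom f, IsMonHom.one_hom f.hom⟩
  map_id _ := rfl
  map_comp _ _ := rfl

end Lie

/-! ### Linear and quantum field theories -/

section Theories

variable (M : Type u) [Category.{v} M] [MonoidalCategory M] [SymmetricCategory M] [Preadditive M]
variable {C D : Type v} [SmallCategory C] [SmallCategory D]

/-- The causality axiom for linear field theories: `[𝔏(f₁)(-), 𝔏(f₂)(-)] = 0` if `f₁ ⊥ f₂`. -/
def IsLFT (perp : OrthogonalityRelation C) : ObjectProperty (C ⥤ ULie M) := fun L =>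
  ∀ ⦃c₁ c₂ c : C⦄ (f₁ : c₁ ⟶ c) (f₂ : c₂ ⟶ c), perp.Rel f₁ f₂ →
    ((L.map f₁).hom ⊗ₘ (L.map f₂).hom) ≫ (L.obj c).bracket = 0

/-- The Einstein causality axiom: the commutator `[𝔄(f₁)(-), 𝔄(f₂)(-)]` vanishes if `f₁ ⊥ f₂`. -/
def IsQFT (perp : OrthogonalityRelation C) : ObjectProperty (C ⥤ Mon M) := fun A =>
  ∀ ⦃c₁ c₂ c : C⦄ (f₁ : c₁ ⟶ c) (f₂ : c₂ ⟶ c), perp.Rel f₁ f₂ →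
    ((A.map f₁).hom ⊗ₘ (A.map f₂).hom) ≫ commutator (A.obj c) = 0

/-- The category of linear field theories, a full subcategory of the category of functors from `C`
to unital Lie algebras. -/
abbrev LFT (perp : OrthogonalityRelation C) := (IsLFT M perp).FullSubcategory

/-- The category of quantum field theories, a full subcategory of the category of functors from
`C` to associative and unital algebras. -/
abbrev QFT (perp : OrthogonalityRelation C) := (IsQFT M perp).FullSubcategory

/-- The restriction functor `j^*` on linear field theories, for the full orthogonal subcategory
`j = P.ι`. -/
def LFT.restrict (perp : OrthogonalityRelation D) (P : ObjectProperty D) :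
    LFT M perp ⥤ LFT M (perp.restrict P) :=
  (IsLFT M (perp.restrict P)).lift
    ((IsLFT M perp).ι ⋙ (Functor.whiskeringLeft _ _ (ULie M)).obj P.ι)
    (fun L _ _ _ f₁ f₂ h => L.property (P.ι.map f₁) (P.ι.map f₂) h)

/-- The restriction functor `j^*` on quantum field theories, for the full orthogonal subcategory
`j = P.ι`. -/
def QFT.restrict (perp : OrthogonalityRelation D) (P : ObjectProperty D) :
    QFT M perp ⥤ QFT M (perp.restrict P) :=
  (IsQFT M (perp.restrict P)).lift
    ((IsQFT M perp).ι ⋙ (Functor.whiskeringLeft _ _ (Mon M)).obj P.ι)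
    (fun A _ _ _ f₁ f₂ h => A.property (P.ι.map f₁) (P.ι.map f₂) h)

/-- The functor `𝔘_lin = (φ^*)_*` from quantum to linear field theories, which applies the
commutator functor objectwise. The linear quantization functor is its left adjoint. -/
def Ulin [MonoidalPreadditive M] (perp : OrthogonalityRelation C) : QFT M perp ⥤ LFT M perp :=
  (IsLFT M perp).lift
    ((IsQFT M perp).ι ⋙ (Functor.whiskeringRight C _ _).obj (commutatorFunctor M))
    (fun A _ _ _ f₁ f₂ h => A.property f₁ f₂ h)

end Theories

/-! ### Locality and constancy -/

section Properties

universe v₁ v₂ u₁ u₂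

/-- For a functor `R` with left adjoint `L`, the property of an object `A` that the component
`L (R A) ⟶ A` of the counit is an isomorphism (see `isIsoCounit_iff` below). Here `L` is Mathlib's
partial left adjoint of `R`: its being defined at `R A` is part of the property, so that nothing
has to be assumed about `R`, and the counit is the morphism which corresponds to the identity of
`R A`. -/
def IsIsoCounit {𝒜 : Type u₁} [Category.{v₁} 𝒜] {ℬ : Type u₂} [Category.{v₂} ℬ] (R : 𝒜 ⥤ ℬ)
    (A : 𝒜) : Prop :=
  ∃ h : R.leftAdjointObjIsDefined (R.obj A),
    IsIso (R.partialLeftAdjointHomEquiv (X := ⟨R.obj A, h⟩) (Y := A)|>.symm (𝟙 (R.obj A)))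

/-- If `R` has a left adjoint then `IsIsoCounit R A` says that the component at `A` of the counit
of the adjunction is an isomorphism, for any choice of the left adjoint. -/
theorem isIsoCounit_iff {𝒜 : Type u₁} [Category.{v₁} 𝒜] {ℬ : Type u₂} [Category.{v₂} ℬ]
    {R : 𝒜 ⥤ ℬ} {L : ℬ ⥤ 𝒜} (adj : L ⊣ R) (A : 𝒜) :
    IsIsoCounit R A ↔ IsIso (adj.counit.app A) := by
  have key (h : R.leftAdjointObjIsDefined (R.obj A)) :
      ∃ e : L.obj (R.obj A) ≅ R.partialLeftAdjointObj ⟨R.obj A, h⟩,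
        e.hom ≫ R.partialLeftAdjointHomEquiv.symm (𝟙 (R.obj A)) = adj.counit.app A := by
    let X : R.PartialLeftAdjointSource := ⟨R.obj A, h⟩
    let u : R.obj A ⟶ R.obj (R.partialLeftAdjointObj X) :=
      R.partialLeftAdjointHomEquiv (X := X) (𝟙 _)
    have hu {Y : 𝒜} (g : R.partialLeftAdjointObj X ⟶ Y) :
        R.partialLeftAdjointHomEquiv g = u ≫ R.map g := by
      rw [← R.partialLeftAdjointHomEquiv_comp, Category.id_comp]
    refine ⟨⟨(adj.homEquiv _ _).symm u, (R.partialLeftAdjointHomEquiv (X := X)).symm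
      (adj.homEquiv _ _ (𝟙 _)), ?_, ?_⟩, ?_⟩
    · apply (adj.homEquiv _ _).injective
      rw [adj.homEquiv_naturality_right, Equiv.apply_symm_apply, ← hu, Equiv.apply_symm_apply]
    · apply (R.partialLeftAdjointHomEquiv (X := X)).injective
      rw [R.partialLeftAdjointHomEquiv_comp, Equiv.apply_symm_apply,
        ← adj.homEquiv_naturality_right, Category.id_comp, Equiv.apply_symm_apply]
    · apply (adj.homEquiv _ _).injective
      rw [adj.homEquiv_naturality_right, Equiv.apply_symm_apply, ← hu (Y := A),
        Equiv.apply_symm_apply]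
      simp [Adjunction.homEquiv_unit]
  constructor
  · rintro ⟨h, hi⟩
    obtain ⟨e, he⟩ := key h
    rw [← he]
    infer_instance
  · intro hi
    have h := Functor.leftAdjointObjIsDefined_of_adjunction adj (R.obj A)
    obtain ⟨e, he⟩ := key h
    refine ⟨h, ?_⟩
    rw [← he] at hi
    exact IsIso.of_isIso_comp_left e.hom _

variable {M : Type u} [Category.{v} M] [MonoidalCategory M] [SymmetricCategory M] [Preadditive M]
variable {C : Type v} [SmallCategory C] {perp : OrthogonalityRelation C}

/-- A linear field theory is `j`-local, for the full orthogonal subcategory `j = P.ι`, if the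
counit `j_! j^* L ⟶ L` is an isomorphism. -/
def LFT.IsJLocal (P : ObjectProperty C) (L : LFT M perp) : Prop :=
  IsIsoCounit (LFT.restrict M perp P) L

/-- A quantum field theory is `j`-local, for the full orthogonal subcategory `j = P.ι`, if the
counit `j_! j^* A ⟶ A` is an isomorphism. -/
def QFT.IsJLocal (P : ObjectProperty C) (A : QFT M perp) : Prop :=
  IsIsoCounit (QFT.restrict M perp P) A

/-- A linear field theory is `W`-constant if it maps every morphism in `W` to an isomorphism of
unital Lie algebras. -/
def LFT.IsWConstant (W : MorphismProperty C) (L : LFT M perp) : Prop :=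
  ∀ ⦃c c' : C⦄ (f : c ⟶ c'), W f → IsIso (L.obj.map f)

/-- A quantum field theory is `W`-constant if it maps every morphism in `W` to an isomorphism of
associative and unital algebras. -/
def QFT.IsWConstant (W : MorphismProperty C) (A : QFT M perp) : Prop :=
  ∀ ⦃c c' : C⦄ (f : c ⟶ c'), W f → IsIso (A.obj.map f)

end Properties

end FieldTheory

/-!
The commutator functor from algebras to unital Lie algebras has a left adjoint, the universal
enveloping algebra: the quotient of the tensor algebra `∐ₙ V^{⊗ n}` by `[x, y] = xy - yx` and by the
identification of the two units. Both constructions only need the monoidal product to preserve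
countable coproducts and coequalizers. A morphism that commutes with generators commutes with
everything they generate, so applying the enveloping algebra objectwise turns causal linear field
theories into causal quantum field theories, and this is left adjoint to `Ulin`.

Being defined objectwise, linear quantization preserves isomorphisms at each morphism of `C` and
commutes with restriction. A counit component `j_! j^* X ⟶ X` is an isomorphism iff
`j^* : Hom(X, Y) ⟶ Hom(j^* X, j^* Y)` is bijective for all `Y`. For `X` the quantization of `L`, the
adjunctions identify this map with `j^* : Hom(L, Ulin Y) ⟶ Hom(j^* L, j^* (Ulin Y))`.
-/

namespace FieldTheory

open MonObj

section Coproducts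

variable {J : Type*} {C D : Type*} [Category* C] [Category* D] (F : C ⥤ D) (f : J → C)
  [HasCoproduct f] [PreservesColimit (Discrete.functor f) F] {Z : D}

lemma map_sigma_hom_ext {g h : F.obj (∐ f) ⟶ Z}
    (w : ∀ j, F.map (Sigma.ι f j) ≫ g = F.map (Sigma.ι f j) ≫ h) : g = h :=
  (isColimitOfPreserves F (coproductIsCoproduct f)).hom_ext fun ⟨j⟩ => w j

/-- The morphism out of the image of a coproduct under a functor that preserves it. -/
noncomputable def mapSigmaDesc (g : ∀ j, F.obj (f j) ⟶ Z) : F.obj (∐ f) ⟶ Z :=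
  (isColimitOfPreserves F (coproductIsCoproduct f)).desc
    ⟨_, Discrete.natTrans fun ⟨j⟩ => g j⟩

lemma map_ι_mapSigmaDesc (g : ∀ j, F.obj (f j) ⟶ Z) (j : J) :
    F.map (Sigma.ι f j) ≫ mapSigmaDesc F f g = g j :=
  (isColimitOfPreserves F (coproductIsCoproduct f)).fac _ ⟨j⟩

end Coproducts

/-! ### The tensor algebra -/

section TensorAlgebra

variable {C : Type u} [Category.{v} C] [MonoidalCategory C]

/-- The tensor power `V ⊗ (V ⊗ ⋯ (V ⊗ 𝟙_ C))`, with `n` factors `V`. -/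
def tensorPower (V : C) : ℕ → C
  | 0 => 𝟙_ C
  | n + 1 => V ⊗ tensorPower V n

variable [HasCoproductsOfShape ℕ C]

/-- The underlying object `∐ₙ V^{⊗ n}` of the tensor algebra of `V`. -/
noncomputable def tensorAlgebra (V : C) : C := ∐ tensorPower V

namespace tensorAlgebra

variable (V : C) {Y Z : C}

/-- The inclusion of the `n`-th tensor power in the tensor algebra. -/
noncomputable def ofPower (n : ℕ) : tensorPower V n ⟶ tensorAlgebra V :=
  Sigma.ι (tensorPower V) n

/-- `ofPower V 0`, with its source written as the monoidal unit. -/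
noncomputable def unit : 𝟙_ C ⟶ tensorAlgebra V := ofPower V 0

/-- `ofPower V (n + 1)`, with its source written as a tensor product. -/
noncomputable def ofPowerSucc (n : ℕ) : V ⊗ tensorPower V n ⟶ tensorAlgebra V :=
  ofPower V (n + 1)

section Left

variable [PreservesColimitsOfShape (Discrete ℕ) (tensorLeft V)]

/-- Left multiplication by generators, which makes the tensor algebra an object with an action
of `V`. -/
noncomputable def cons : V ⊗ tensorAlgebra V ⟶ tensorAlgebra V :=
  mapSigmaDesc (tensorLeft V) (tensorPower V) (ofPowerSucc V)

lemma whiskerLeft_ofPower_cons (n : ℕ) : V ◁ ofPower V n ≫ cons V = ofPowerSucc V n :=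
  map_ι_mapSigmaDesc (tensorLeft V) _ _ n

/-- The inclusion of the generators in the tensor algebra. -/
noncomputable def gen : V ⟶ tensorAlgebra V := (ρ_ V).inv ≫ V ◁ unit V ≫ cons V

variable {V} in
lemma ofPowerSucc_whiskerRight (n : ℕ) (f : tensorAlgebra V ⊗ Y ⟶ Z) :
    ofPowerSucc V n ▷ Y ≫ f = (α_ V (tensorPower V n) Y).hom ≫
      V ◁ (ofPower V n ▷ Y) ≫ (α_ V (tensorAlgebra V) Y).inv ≫ cons V ▷ Y ≫ f := by
  simp [← whiskerLeft_ofPower_cons]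

end Left

variable {V}

/-- The iterated action `V ⊗ (V ⊗ ⋯ ) ⊗ Y ⟶ Z` on the image of `Y`. -/
def powerDesc (y : Y ⟶ Z) (a : V ⊗ Z ⟶ Z) : ∀ n, tensorPower V n ⊗ Y ⟶ Z
  | 0 => (λ_ Y).hom ≫ y
  | n + 1 => (α_ V (tensorPower V n) Y).hom ≫ V ◁ powerDesc y a n ≫ a

section Right

variable [PreservesColimitsOfShape (Discrete ℕ) (tensorRight Y)]

/-- The extension of `y : Y ⟶ Z` along an action `a` of `V` on `Z`: the object `tensorAlgebra V ⊗ Y`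
is free on `Y` among the objects with an action of `V`. -/
noncomputable def desc (y : Y ⟶ Z) (a : V ⊗ Z ⟶ Z) : tensorAlgebra V ⊗ Y ⟶ Z :=
  mapSigmaDesc (tensorRight Y) (tensorPower V) (powerDesc y a)

lemma ofPower_desc (y : Y ⟶ Z) (a : V ⊗ Z ⟶ Z) (n : ℕ) :
    ofPower V n ▷ Y ≫ desc y a = powerDesc y a n :=
  map_ι_mapSigmaDesc (tensorRight Y) _ _ n

lemma unit_desc (y : Y ⟶ Z) (a : V ⊗ Z ⟶ Z) : unit V ▷ Y ≫ desc y a = (λ_ Y).hom ≫ y :=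
  ofPower_desc y a 0

lemma ofPowerSucc_desc (y : Y ⟶ Z) (a : V ⊗ Z ⟶ Z) (n : ℕ) :
    ofPowerSucc V n ▷ Y ≫ desc y a =
      (α_ V (tensorPower V n) Y).hom ≫ V ◁ (ofPower V n ▷ Y ≫ desc y a) ≫ a := by
  rw [ofPower_desc]
  exact ofPower_desc y a (n + 1)

lemma cons_desc [∀ X : C, PreservesColimitsOfShape (Discrete ℕ) (tensorLeft X)]
    (y : Y ⟶ Z) (a : V ⊗ Z ⟶ Z) :
    cons V ▷ Y ≫ desc y a = (α_ V (tensorAlgebra V) Y).hom ≫ V ◁ desc y a ≫ a := by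
  rw [← Iso.inv_comp_eq]
  refine map_sigma_hom_ext (tensorRight Y ⋙ tensorLeft V) (tensorPower V) fun n => ?_
  change V ◁ (ofPower V n ▷ Y) ≫ _ = V ◁ (ofPower V n ▷ Y) ≫ _
  rw [← cancel_epi (α_ V (tensorPower V n) Y).hom, ← ofPowerSucc_whiskerRight, ofPowerSucc_desc,
    MonoidalCategory.whiskerLeft_comp_assoc]

lemma hom_ext [PreservesColimitsOfShape (Discrete ℕ) (tensorLeft V)] (a : V ⊗ Z ⟶ Z)
    {f g : tensorAlgebra V ⊗ Y ⟶ Z} (h : unit V ▷ Y ≫ f = unit V ▷ Y ≫ g)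
    (hf : cons V ▷ Y ≫ f = (α_ V (tensorAlgebra V) Y).hom ≫ V ◁ f ≫ a)
    (hg : cons V ▷ Y ≫ g = (α_ V (tensorAlgebra V) Y).hom ≫ V ◁ g ≫ a) : f = g := by
  refine map_sigma_hom_ext (tensorRight Y) (tensorPower V) fun n => ?_
  change ofPower V n ▷ Y ≫ f = ofPower V n ▷ Y ≫ g
  induction n with
  | zero => exact h
  | succ n ih =>
    change ofPowerSucc V n ▷ Y ≫ f = ofPowerSucc V n ▷ Y ≫ g
    simp only [ofPowerSucc_whiskerRight, hf, hg, Iso.inv_hom_id_assoc,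
      ← MonoidalCategory.whiskerLeft_comp_assoc, ih]

end Right

section Lift

variable [PreservesColimitsOfShape (Discrete ℕ) (tensorRight (𝟙_ C))] {A : C} [MonObj A]

/-- The algebra morphism that extends a morphism defined on generators. -/
noncomputable def lift (i : V ⟶ A) : tensorAlgebra V ⟶ A :=
  (ρ_ (tensorAlgebra V)).inv ≫ desc η (i ▷ A ≫ μ)

lemma unit_lift (i : V ⟶ A) : unit V ≫ lift i = η := by
  rw [lift, rightUnitor_inv_naturality_assoc, unit_desc, unitors_equal, Iso.inv_hom_id_assoc]

end Lift

section Algebra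

variable [∀ X : C, PreservesColimitsOfShape (Discrete ℕ) (tensorLeft X)]
  [∀ X : C, PreservesColimitsOfShape (Discrete ℕ) (tensorRight X)]

noncomputable instance : MonObj (tensorAlgebra V) where
  one := unit V
  mul := desc (𝟙 _) (cons V)
  one_mul := by rw [unit_desc, Category.comp_id]
  mul_one := by
    refine hom_ext (cons V) ?_ ?_ ?_
    · rw [← whisker_exchange_assoc, unit_desc]
      simp [unitors_equal]
    · rw [← whisker_exchange_assoc, cons_desc]
      simp
    · simp
  mul_assoc := by
    rw [← Iso.inv_comp_eq]
    refine hom_ext (cons V) ?_ ?_ ?_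
    · rw [associator_inv_naturality_left_assoc, ← comp_whiskerRight_assoc, unit_desc,
        ← whisker_exchange_assoc, unit_desc]
      simp
    · rw [associator_inv_naturality_left_assoc, ← comp_whiskerRight_assoc, cons_desc]
      simp [cons_desc]
    · rw [← whisker_exchange_assoc, cons_desc]
      simp

lemma cons_mul : cons V ▷ tensorAlgebra V ≫ μ =
    (α_ V (tensorAlgebra V) (tensorAlgebra V)).hom ≫ V ◁ μ ≫ cons V :=
  cons_desc _ _

lemma gen_mul : gen V ▷ tensorAlgebra V ≫ μ = cons V := by
  have unit_mul : unit V ▷ tensorAlgebra V ≫ μ = (λ_ (tensorAlgebra V)).hom := one_mul _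
  simp only [gen, comp_whiskerRight, Category.assoc, cons_mul, whisker_assoc,
    Iso.inv_hom_id_assoc, ← MonoidalCategory.whiskerLeft_comp_assoc, unit_mul]
  simp

variable {A : C} [MonObj A]

lemma ofPowerSucc_comp (f : tensorAlgebra V ⟶ A) [IsMonHom f] (n : ℕ) :
    ofPowerSucc V n ≫ f = ((gen V ≫ f) ⊗ₘ (ofPower V n ≫ f)) ≫ μ := by
  rw [← whiskerLeft_ofPower_cons, ← gen_mul, Category.assoc, Category.assoc, IsMonHom.mul_hom f,
    ← tensorHom_id, ← id_tensorHom, tensorHom_comp_tensorHom_assoc,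
    tensorHom_comp_tensorHom_assoc]
  simp only [Category.id_comp, Category.comp_id]

lemma monHom_ext {f g : tensorAlgebra V ⟶ A} [IsMonHom f] [IsMonHom g]
    (h : gen V ≫ f = gen V ≫ g) : f = g := by
  refine Sigma.hom_ext _ _ fun n => ?_
  change ofPower V n ≫ f = ofPower V n ≫ g
  induction n with
  | zero => exact (IsMonHom.one_hom f).trans (IsMonHom.one_hom g).symm
  | succ n ih =>
    change ofPowerSucc V n ≫ f = ofPowerSucc V n ≫ g
    rw [ofPowerSucc_comp, ofPowerSucc_comp, h, ih]

lemma cons_lift (i : V ⟶ A) : cons V ≫ lift i = V ◁ lift i ≫ i ▷ A ≫ μ := by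
  rw [lift, rightUnitor_inv_naturality_assoc, cons_desc]
  simp

lemma gen_lift (i : V ⟶ A) : gen V ≫ lift i = i := by
  simp only [gen, Category.assoc, cons_lift, ← MonoidalCategory.whiskerLeft_comp_assoc, unit_lift]
  rw [whisker_exchange_assoc, mul_one, rightUnitor_naturality, Iso.inv_hom_id_assoc]

instance (i : V ⟶ A) : IsMonHom (lift i) where
  one_hom := unit_lift i
  mul_hom := by
    refine hom_ext (i ▷ A ≫ μ) ?_ ?_ ?_
    · have unit_mul : unit V ▷ tensorAlgebra V ≫ μ = (λ_ (tensorAlgebra V)).hom := one_mul _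
      rw [reassoc_of% unit_mul, MonoidalCategory.tensorHom_def', Category.assoc,
        ← whisker_exchange_assoc, ← comp_whiskerRight_assoc, unit_lift]
      simp
    · rw [reassoc_of% cons_mul, cons_lift]
      simp
    · rw [MonoidalCategory.tensorHom_def', Category.assoc, ← whisker_exchange_assoc,
        ← comp_whiskerRight_assoc, cons_lift]
      simp only [comp_whiskerRight, whisker_assoc, Category.assoc, mul_assoc,
        associator_naturality_left_assoc, associator_naturality_right_assoc,
        ← whisker_exchange_assoc, Iso.inv_hom_id_assoc,
        MonoidalCategory.whiskerLeft_comp]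

end Algebra

end tensorAlgebra

end TensorAlgebra

/-! ### Quotients of monoid objects -/

section Quotient

variable {C : Type u} [Category.{v} C] [MonoidalCategory C] {A R : C} [MonObj A]

/-- The morphism `a ⊗ (x ⊗ b) ↦ a * r x * b`. -/
def sandwich (r : R ⟶ A) : A ⊗ (R ⊗ A) ⟶ A := A ◁ (r ▷ A ≫ μ) ≫ μ

lemma whiskerLeft_sandwich_mul (r : R ⟶ A) :
    A ◁ sandwich r ≫ μ = (α_ A A (R ⊗ A)).inv ≫ μ ▷ (R ⊗ A) ≫ sandwich r := by
  rw [sandwich, ← whisker_exchange_assoc]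
  simp

lemma sandwich_whiskerRight_mul (r : R ⟶ A) :
    sandwich r ▷ A ≫ μ =
      (α_ A (R ⊗ A) A).hom ≫ A ◁ ((α_ R A A).hom ≫ R ◁ μ) ≫ sandwich r := by
  simp only [sandwich, comp_whiskerRight, whisker_assoc, Category.assoc, mul_assoc,
    Iso.inv_hom_id_assoc]
  simp only [← MonoidalCategory.whiskerLeft_comp_assoc, mul_assoc, Category.assoc,
    associator_naturality_left_assoc, whisker_exchange_assoc]

lemma sandwich_comp {B : C} [MonObj B] (r : R ⟶ A) (f : A ⟶ B) [IsMonHom f] :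
    sandwich r ≫ f = (f ⊗ₘ ((r ≫ f) ⊗ₘ f) ≫ μ) ≫ μ := by
  rw [sandwich, Category.assoc, IsMonHom.mul_hom f, ← id_tensorHom, ← tensorHom_id,
    tensorHom_comp_tensorHom_assoc, Category.assoc, IsMonHom.mul_hom f,
    tensorHom_comp_tensorHom_assoc, Category.id_comp]

lemma one_tensorHom_one_sandwich (r : R ⟶ A) :
    (η ⊗ₘ (R ◁ η)) ≫ sandwich r = (λ_ _).hom ≫ (ρ_ R).hom ≫ r := by
  rw [sandwich, MonoidalCategory.tensorHom_def, Category.assoc,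
    ← MonoidalCategory.whiskerLeft_comp_assoc, whisker_exchange_assoc, mul_one,
    rightUnitor_naturality, ← whisker_exchange_assoc, one_mul, leftUnitor_naturality]

variable [HasCoequalizers C]

/-- The quotient of `A` by the smallest congruence that identifies `r` and `s`. -/
noncomputable def monQuotient (r s : R ⟶ A) : C := coequalizer (sandwich r) (sandwich s)

namespace monQuotient

variable (r s : R ⟶ A)

/-- The projection to the quotient. -/
noncomputable def π : A ⟶ monQuotient r s := coequalizer.π _ _

instance : Epi (π r s) := inferInstanceAs (Epi (coequalizer.π _ _))

lemma sandwich_π : sandwich r ≫ π r s = sandwich s ≫ π r s := coequalizer.condition _ _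

lemma comp_π : r ≫ π r s = s ≫ π r s := by
  rw [← cancel_epi (ρ_ R).hom, ← cancel_epi (λ_ (R ⊗ 𝟙_ C)).hom,
    ← reassoc_of% one_tensorHom_one_sandwich, ← reassoc_of% one_tensorHom_one_sandwich, sandwich_π]

section Desc

variable {r s} {B : C} [MonObj B] (f : A ⟶ B) [IsMonHom f] (h : r ≫ f = s ≫ f)

/-- The morphism out of the quotient. -/
noncomputable def desc : monQuotient r s ⟶ B :=
  coequalizer.desc f (by rw [sandwich_comp, sandwich_comp, h])

lemma π_desc : π r s ≫ desc f h = f := coequalizer.π_desc _ _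

end Desc

section Left

variable [∀ X : C, PreservesColimitsOfShape WalkingParallelPair (tensorLeft X)]

instance (X : C) : Epi (X ◁ π r s) :=
  inferInstanceAs (Epi ((tensorLeft X).map (coequalizer.π _ _)))

/-- The action of `A` on its quotient by left multiplication. -/
noncomputable def leftMul : A ⊗ monQuotient r s ⟶ monQuotient r s :=
  (PreservesCoequalizer.iso (tensorLeft A) (sandwich r) (sandwich s)).inv ≫
    coequalizer.desc (μ ≫ π r s) (by
      change A ◁ sandwich r ≫ _ = A ◁ sandwich s ≫ _
      rw [reassoc_of% whiskerLeft_sandwich_mul, reassoc_of% whiskerLeft_sandwich_mul, sandwich_π])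

lemma whiskerLeft_π_leftMul : A ◁ π r s ≫ leftMul r s = μ ≫ π r s :=
  map_π_preserves_coequalizer_inv_desc (tensorLeft A) _ _ _ _

lemma sandwich_whiskerRight_leftMul :
    sandwich r ▷ monQuotient r s ≫ leftMul r s = sandwich s ▷ monQuotient r s ≫ leftMul r s := by
  rw [← cancel_epi (_ ◁ π r s), whisker_exchange_assoc, whisker_exchange_assoc,
    whiskerLeft_π_leftMul, reassoc_of% sandwich_whiskerRight_mul,
    reassoc_of% sandwich_whiskerRight_mul, sandwich_π]

end Left

section Right

variable [∀ X : C, PreservesColimitsOfShape WalkingParallelPair (tensorRight X)]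

instance (X : C) : Epi (π r s ▷ X) :=
  inferInstanceAs (Epi ((tensorRight X).map (coequalizer.π _ _)))

variable [∀ X : C, PreservesColimitsOfShape WalkingParallelPair (tensorLeft X)]

/-- The multiplication of the quotient, which descends from that of `A` in one factor at a time. -/
noncomputable def mul : monQuotient r s ⊗ monQuotient r s ⟶ monQuotient r s :=
  (PreservesCoequalizer.iso (tensorRight _) (sandwich r) (sandwich s)).inv ≫
    coequalizer.desc (leftMul r s) (sandwich_whiskerRight_leftMul r s)

lemma π_whiskerRight_mul : π r s ▷ monQuotient r s ≫ mul r s = leftMul r s :=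
  map_π_preserves_coequalizer_inv_desc (tensorRight _) _ _ _ _

lemma π_tensorHom_π_mul : (π r s ⊗ₘ π r s) ≫ mul r s = μ ≫ π r s := by
  rw [MonoidalCategory.tensorHom_def', Category.assoc, π_whiskerRight_mul, whiskerLeft_π_leftMul]

instance : Epi (π r s ⊗ₘ π r s) := by
  rw [MonoidalCategory.tensorHom_def]
  infer_instance

instance : Epi ((π r s ⊗ₘ π r s) ⊗ₘ π r s) := by
  have : Epi (π r s ▷ A ▷ A) := inferInstanceAs
    (Epi ((tensorRight A ⋙ tensorRight A).map (coequalizer.π (sandwich r) (sandwich s))))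
  have : Epi ((monQuotient r s ◁ π r s) ▷ A) := inferInstanceAs
    (Epi ((tensorLeft _ ⋙ tensorRight A).map (coequalizer.π (sandwich r) (sandwich s))))
  rw [MonoidalCategory.tensorHom_def, MonoidalCategory.tensorHom_def, comp_whiskerRight]
  infer_instance

noncomputable instance : MonObj (monQuotient r s) where
  one := η ≫ π r s
  mul := mul r s
  one_mul := by
    rw [← cancel_epi (_ ◁ π r s), comp_whiskerRight_assoc, π_whiskerRight_mul,
      whisker_exchange_assoc, whiskerLeft_π_leftMul]
    simp
  mul_one := by
    rw [← cancel_epi (π r s ▷ _), ← whisker_exchange_assoc,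
      π_whiskerRight_mul, MonoidalCategory.whiskerLeft_comp_assoc, whiskerLeft_π_leftMul]
    simp
  mul_assoc := by
    rw [← cancel_epi ((π r s ⊗ₘ π r s) ⊗ₘ π r s), associator_naturality_assoc, ← id_tensorHom,
      ← tensorHom_id, tensorHom_comp_tensorHom_assoc, tensorHom_comp_tensorHom_assoc,
      π_tensorHom_π_mul, Category.comp_id]
    have mul_π_left : ((μ ≫ π r s) ⊗ₘ π r s) = μ ▷ A ≫ (π r s ⊗ₘ π r s) := by
      rw [← tensorHom_id, tensorHom_comp_tensorHom, Category.id_comp]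
    have mul_π_right : (π r s ⊗ₘ (μ ≫ π r s)) = A ◁ μ ≫ (π r s ⊗ₘ π r s) := by
      rw [← id_tensorHom, tensorHom_comp_tensorHom, Category.id_comp]
    rw [mul_π_left, mul_π_right, Category.assoc, Category.assoc, π_tensorHom_π_mul]
    simp

instance : IsMonHom (π r s) where
  one_hom := rfl
  mul_hom := (π_tensorHom_π_mul r s).symm

variable {r s} {B : C} [MonObj B] (f : A ⟶ B) [IsMonHom f] (h : r ≫ f = s ≫ f)

instance : IsMonHom (desc f h) where
  one_hom := (Category.assoc _ _ _).trans (by rw [π_desc, IsMonHom.one_hom])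
  mul_hom := by
    rw [← cancel_epi (π r s ⊗ₘ π r s), ← reassoc_of% IsMonHom.mul_hom (π r s), π_desc,
      tensorHom_comp_tensorHom_assoc, π_desc, IsMonHom.mul_hom f]

end Right

end monQuotient

end Quotient

/-! ### Commuting morphisms -/

section Commutes

variable {C : Type u} [Category.{v} C] [MonoidalCategory C] {A : C} [MonObj A] {X Y Z : C}

lemma tensorHom_mul_tensorHom_mul (f : X ⟶ A) (g : Y ⟶ A) (h : Z ⟶ A) :
    (((f ⊗ₘ g) ≫ μ) ⊗ₘ h) ≫ μ = (α_ X Y Z).hom ≫ (f ⊗ₘ ((g ⊗ₘ h) ≫ μ)) ≫ μ := by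
  rw [← tensorHom_comp_whiskerRight_assoc, mul_assoc, associator_naturality_assoc,
    tensorHom_comp_whiskerLeft_assoc]

/-- Two morphisms to a monoid object commute if their product does not depend on the order of
the factors. -/
def Commutes [BraidedCategory C] (f : X ⟶ A) (g : Y ⟶ A) : Prop :=
  (f ⊗ₘ g) ≫ μ = (β_ X Y).hom ≫ (g ⊗ₘ f) ≫ μ

lemma Commutes.symm [SymmetricCategory C] {f : X ⟶ A} {g : Y ⟶ A} (h : Commutes f g) :
    Commutes g f := by
  rw [Commutes, h, SymmetricCategory.symmetry_assoc]

lemma commutator_comp [SymmetricCategory C] [Preadditive C] {B : C} [MonObj B] (f : A ⟶ B)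
    [IsMonHom f] : commutator (.mk A) ≫ f = (f ⊗ₘ f) ≫ commutator (.mk B) :=
  commutator_hom (A := .mk A) (B := .mk B) (.mk' f)

lemma commutes_iff_tensorHom_comp_commutator [SymmetricCategory C] [Preadditive C] {A : Mon C}
    {f : X ⟶ A.X} {g : Y ⟶ A.X} : Commutes f g ↔ (f ⊗ₘ g) ≫ commutator A = 0 := by
  rw [commutator, Preadditive.comp_sub, sub_eq_zero, BraidedCategory.braiding_naturality_assoc,
    Commutes]

variable [BraidedCategory C]

lemma commutes_comp_left_iff (p : Z ⟶ X) (f : X ⟶ A) (g : Y ⟶ A) :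
    Commutes (p ≫ f) g ↔ p ▷ Y ≫ (f ⊗ₘ g) ≫ μ = p ▷ Y ≫ (β_ X Y).hom ≫ (g ⊗ₘ f) ≫ μ := by
  rw [Commutes, BraidedCategory.braiding_naturality_left_assoc, whiskerRight_comp_tensorHom_assoc,
    whiskerLeft_comp_tensorHom_assoc]

lemma one_commutes (g : Y ⟶ A) : Commutes η g := by
  rw [Commutes, tensorHom_def'_assoc, MonObj.one_mul, MonoidalCategory.tensorHom_def_assoc,
    MonObj.mul_one]
  simp

lemma Commutes.mul_left {f : X ⟶ A} {f' : Y ⟶ A} {g : Z ⟶ A} (h : Commutes f g)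
    (h' : Commutes f' g) : Commutes ((f ⊗ₘ f') ≫ μ) g := by
  calc (((f ⊗ₘ f') ≫ μ) ⊗ₘ g) ≫ μ
    _ = (α_ X Y Z).hom ≫ (f ⊗ₘ ((f' ⊗ₘ g) ≫ μ)) ≫ μ := tensorHom_mul_tensorHom_mul f f' g
    _ = (α_ X Y Z).hom ≫ X ◁ (β_ Y Z).hom ≫ (f ⊗ₘ ((g ⊗ₘ f') ≫ μ)) ≫ μ := by
      rw [h', whiskerLeft_comp_tensorHom_assoc]
    _ = (α_ X Y Z).hom ≫ X ◁ (β_ Y Z).hom ≫ (α_ X Z Y).inv ≫ (((f ⊗ₘ g) ≫ μ) ⊗ₘ f') ≫ μ := by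
      rw [tensorHom_mul_tensorHom_mul, Iso.inv_hom_id_assoc]
    _ = (α_ X Y Z).hom ≫ X ◁ (β_ Y Z).hom ≫ (α_ X Z Y).inv ≫ (β_ X Z).hom ▷ Y ≫
        (α_ Z X Y).hom ≫ (g ⊗ₘ ((f ⊗ₘ f') ≫ μ)) ≫ μ := by
      rw [h, ← whiskerRight_comp_tensorHom_assoc, tensorHom_mul_tensorHom_mul]
    _ = (β_ (X ⊗ Y) Z).hom ≫ (g ⊗ₘ ((f ⊗ₘ f') ≫ μ)) ≫ μ := by
      simp only [BraidedCategory.braiding_tensor_left_hom, Category.assoc]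

lemma tensorAlgebra.commutes_of_gen [HasCoproductsOfShape ℕ C]
    [∀ X : C, PreservesColimitsOfShape (Discrete ℕ) (tensorLeft X)]
    [∀ X : C, PreservesColimitsOfShape (Discrete ℕ) (tensorRight X)]
    (f : tensorAlgebra X ⟶ A) [IsMonHom f] {g : Y ⟶ A} (h : Commutes (gen X ≫ f) g) :
    Commutes f g := by
  have commutes_ofPower (n : ℕ) : Commutes (ofPower X n ≫ f) g := by
    induction n with
    | zero => exact (IsMonHom.one_hom f).symm ▸ one_commutes g
    | succ n ih => exact (ofPowerSucc_comp f n).symm ▸ h.mul_left ih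
  exact map_sigma_hom_ext (tensorRight Y) (tensorPower X) fun n =>
    (commutes_comp_left_iff _ _ _).1 (commutes_ofPower n)

lemma Commutes.of_epi_comp (p : Z ⟶ X) [Epi (p ▷ Y)] {f : X ⟶ A} {g : Y ⟶ A}
    (h : Commutes (p ≫ f) g) : Commutes f g :=
  (cancel_epi _).1 ((commutes_comp_left_iff _ _ _).1 h)

end Commutes

/-! ### The universal enveloping algebra -/

section Envelope

variable {M : Type u} [Category.{v} M] [MonoidalCategory M]

instance [BraidedCategory M] {J : Type*} [Category* J] (X : M)
    [PreservesColimitsOfShape J (tensorLeft X)] : PreservesColimitsOfShape J (tensorRight X) :=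
  preservesColimitsOfShape_of_natIso (BraidedCategory.tensorLeftIsoTensorRight X)

variable [SymmetricCategory M] [Preadditive M] [HasCountableColimits M]
  [∀ X : M, PreservesColimitsOfShape (Discrete ℕ) (tensorLeft X)]

namespace envelopingAlgebra

open tensorAlgebra (gen)

/-- One side of the defining relations of the universal enveloping algebra: `[x, y]` on the
summand `V ⊗ V` and the unit of the Lie algebra on the summand `𝟙_ M`. -/
noncomputable def relationLeft (V : ULie M) : V.X ⊗ V.X ⨿ 𝟙_ M ⟶ tensorAlgebra V.X :=
  coprod.desc (V.bracket ≫ gen V.X) (V.unit ≫ gen V.X)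

/-- The other side of the defining relations of the universal enveloping algebra: `xy - yx` on the
summand `V ⊗ V` and the unit of the tensor algebra on the summand `𝟙_ M`. -/
noncomputable def relationRight (V : ULie M) : V.X ⊗ V.X ⨿ 𝟙_ M ⟶ tensorAlgebra V.X :=
  coprod.desc ((gen V.X ⊗ₘ gen V.X) ≫ commutator (.mk (tensorAlgebra V.X))) η

end envelopingAlgebra

/-- The universal enveloping algebra of a unital Lie algebra: the quotient of the tensor algebra
by the relations `[x, y] = xy - yx` and by the identification of the two units. -/
noncomputable def envelopingAlgebra (V : ULie M) : M :=
  monQuotient (envelopingAlgebra.relationLeft V) (envelopingAlgebra.relationRight V)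

namespace envelopingAlgebra

open tensorAlgebra (gen)

/-- The quotient map from the tensor algebra. -/
noncomputable def π (V : ULie M) : tensorAlgebra V.X ⟶ envelopingAlgebra V :=
  monQuotient.π _ _

lemma relation_π (V : ULie M) : relationLeft V ≫ π V = relationRight V ≫ π V :=
  monQuotient.comp_π _ _

/-- The canonical morphism from a unital Lie algebra to its universal enveloping algebra. -/
noncomputable def incl (V : ULie M) : V.X ⟶ envelopingAlgebra V := gen V.X ≫ π V

section Lift

variable {V : ULie M} {A : M} [MonObj A]

lemma relation_lift {i : V.X ⟶ A} (bracket_comp : V.bracket ≫ i = (i ⊗ₘ i) ≫ commutator (.mk A))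
    (unit_comp : V.unit ≫ i = η) :
    relationLeft V ≫ tensorAlgebra.lift i = relationRight V ≫ tensorAlgebra.lift i := by
  rw [relationLeft, relationRight, coprod.desc_comp, coprod.desc_comp, Category.assoc,
    Category.assoc, Category.assoc, commutator_comp, tensorHom_comp_tensorHom_assoc,
    tensorAlgebra.gen_lift, IsMonHom.one_hom, bracket_comp, unit_comp]

variable {i : V.X ⟶ A} (bracket_comp : V.bracket ≫ i = (i ⊗ₘ i) ≫ commutator (.mk A))
  (unit_comp : V.unit ≫ i = η)

/-- The algebra morphism out of the universal enveloping algebra which is induced by a morphism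
that takes brackets to commutators and preserves the unit. -/
noncomputable def lift : envelopingAlgebra V ⟶ A :=
  monQuotient.desc (tensorAlgebra.lift i) (relation_lift bracket_comp unit_comp)

lemma incl_lift : incl V ≫ lift bracket_comp unit_comp = i := by
  have π_lift : π V ≫ lift bracket_comp unit_comp = tensorAlgebra.lift i :=
    monQuotient.π_desc _ _
  rw [incl, Category.assoc, π_lift, tensorAlgebra.gen_lift]

end Lift

end envelopingAlgebra

variable [∀ X : M, PreservesColimitsOfShape WalkingParallelPair (tensorLeft X)]

namespace envelopingAlgebra

noncomputable instance (V : ULie M) : MonObj (envelopingAlgebra V) :=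
  inferInstanceAs (MonObj (monQuotient _ _))

instance (V : ULie M) : IsMonHom (π V) := inferInstanceAs (IsMonHom (monQuotient.π _ _))

instance (V : ULie M) : Epi (π V) := inferInstanceAs (Epi (monQuotient.π _ _))

instance (V : ULie M) (X : M) : Epi (π V ▷ X) := inferInstanceAs (Epi (monQuotient.π _ _ ▷ X))

lemma bracket_incl (V : ULie M) :
    V.bracket ≫ incl V = (incl V ⊗ₘ incl V) ≫ commutator (.mk (envelopingAlgebra V)) := by
  have h := coprod.inl ≫= relation_π V
  rw [relationLeft, relationRight, coprod.inl_desc_assoc, coprod.inl_desc_assoc, Category.assoc,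
    Category.assoc, commutator_comp] at h
  rw [incl, h, tensorHom_comp_tensorHom_assoc]

lemma unit_incl (V : ULie M) : V.unit ≫ incl V = η := by
  have h := coprod.inr ≫= relation_π V
  rwa [relationLeft, relationRight, coprod.inr_desc_assoc, coprod.inr_desc_assoc, Category.assoc,
    IsMonHom.one_hom] at h

variable {V : ULie M} {A : M} [MonObj A]

lemma commutes_of_incl {Y : M} (f : envelopingAlgebra V ⟶ A) [IsMonHom f] {g : Y ⟶ A}
    (h : Commutes (incl V ≫ f) g) : Commutes f g :=
  .of_epi_comp (π V) (tensorAlgebra.commutes_of_gen (π V ≫ f) (Category.assoc _ _ f ▸ h))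

lemma commutes_hom_of_incl {W : ULie M} {A : Mon M} {f : .mk (envelopingAlgebra V) ⟶ A}
    {g : .mk (envelopingAlgebra W) ⟶ A} (h : Commutes (incl V ≫ f.hom) (incl W ≫ g.hom)) :
    Commutes f.hom g.hom :=
  commutes_of_incl f.hom (commutes_of_incl g.hom h.symm).symm

lemma monHom_ext {f g : envelopingAlgebra V ⟶ A} [IsMonHom f] [IsMonHom g]
    (h : incl V ≫ f = incl V ≫ g) : f = g := by
  rw [incl, Category.assoc, Category.assoc] at h
  exact (cancel_epi (π V)).1 (tensorAlgebra.monHom_ext h)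

instance isMonHom_lift {i : V.X ⟶ A}
    (bracket_comp : V.bracket ≫ i = (i ⊗ₘ i) ≫ commutator (.mk A)) (unit_comp : V.unit ≫ i = η) :
    IsMonHom (lift bracket_comp unit_comp) :=
  inferInstanceAs (IsMonHom (monQuotient.desc _ _))

variable [MonoidalPreadditive M]

/-- The canonical morphism from a unital Lie algebra to its universal enveloping algebra, as a
morphism of unital Lie algebras. -/
noncomputable def inclHom (V : ULie M) :
    V ⟶ (commutatorFunctor M).obj (.mk (envelopingAlgebra V)) :=
  ULie.Hom.mk (incl V) (bracket_incl V) (unit_incl V)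

variable {A : Mon M}

/-- The algebra morphism out of the universal enveloping algebra which is induced by a morphism of
unital Lie algebras. -/
noncomputable def liftHom (g : V ⟶ (commutatorFunctor M).obj A) :
    .mk (envelopingAlgebra V) ⟶ A where
  hom := lift (A := A.X) g.bracket_hom g.unit_hom
  isMonHom_hom := isMonHom_lift _ _

lemma inclHom_liftHom (g : V ⟶ (commutatorFunctor M).obj A) :
    inclHom V ≫ (commutatorFunctor M).map (liftHom g) = g :=
  ULie.Hom.ext (incl_lift (A := A.X) g.bracket_hom g.unit_hom)

lemma hom_ext {f g : .mk (envelopingAlgebra V) ⟶ A}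
    (h : inclHom V ≫ (commutatorFunctor M).map f = inclHom V ≫ (commutatorFunctor M).map g) :
    f = g :=
  Mon.Hom.ext (monHom_ext (congrArg ULie.Hom.hom h))

/-- The universal property of the universal enveloping algebra. -/
noncomputable def homEquiv (V : ULie M) (A : Mon M) :
    (.mk (envelopingAlgebra V) ⟶ A) ≃ (V ⟶ (commutatorFunctor M).obj A) where
  toFun f := inclHom V ≫ (commutatorFunctor M).map f
  invFun := liftHom
  left_inv _ := hom_ext (inclHom_liftHom _)
  right_inv := inclHom_liftHom

end envelopingAlgebra

variable (M) [MonoidalPreadditive M]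

/-- The universal enveloping algebra functor. -/
noncomputable def envelope : ULie M ⥤ Mon M :=
  Adjunction.leftAdjointOfEquiv (G := commutatorFunctor M) envelopingAlgebra.homEquiv
    (fun _ _ _ _ _ => by simp [envelopingAlgebra.homEquiv])

/-- The universal enveloping algebra functor is left adjoint to the commutator functor. -/
noncomputable def envelopeAdjunction : envelope M ⊣ commutatorFunctor M :=
  Adjunction.adjunctionOfEquivLeft _ _

variable {M}

lemma envelopeAdjunction_unit_app (V : ULie M) :
    (envelopeAdjunction M).unit.app V = envelopingAlgebra.inclHom V :=
  (_ ≫= (commutatorFunctor M).map_id _).trans (Category.comp_id _)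

lemma incl_envelope_map {V W : ULie M} (f : V ⟶ W) :
    envelopingAlgebra.incl V ≫ ((envelope M).map f).hom = f.hom ≫ envelopingAlgebra.incl W := by
  have h := (envelopeAdjunction M).unit_naturality f
  rw [envelopeAdjunction_unit_app, envelopeAdjunction_unit_app] at h
  exact congrArg ULie.Hom.hom h

end Envelope

/-! ### Counits and adjunctions -/

section Counit

universe v₁ v₂ v₃ v₄ u₁ u₂ u₃ u₄

variable {𝒜 : Type u₁} [Category.{v₁} 𝒜] {ℬ : Type u₂} [Category.{v₂} ℬ]
  {𝒜' : Type u₃} [Category.{v₃} 𝒜'] {ℬ' : Type u₄} [Category.{v₄} ℬ']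

theorem isIsoCounit_iff_bijective_map (R : 𝒜 ⥤ ℬ) (A : 𝒜) :
    IsIsoCounit R A ↔ ∀ A' : 𝒜, Function.Bijective fun g : A ⟶ A' => R.map g := by
  have homEquiv_counit_comp (h : R.leftAdjointObjIsDefined (R.obj A)) (A' : 𝒜) :
      R.partialLeftAdjointHomEquiv (X := ⟨R.obj A, h⟩) ∘
        (fun g : A ⟶ A' => R.partialLeftAdjointHomEquiv.symm (𝟙 (R.obj A)) ≫ g) = R.map := by
    funext g
    rw [Function.comp_apply, R.partialLeftAdjointHomEquiv_comp, Equiv.apply_symm_apply]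
    exact Category.id_comp _
  constructor
  · rintro ⟨h, hiso⟩ A'
    exact homEquiv_counit_comp h A' ▸ (Equiv.bijective _).comp
      ((isIso_iff_coyoneda_map_bijective _).1 hiso A')
  · intro hbij
    have h : R.leftAdjointObjIsDefined (R.obj A) :=
      (R.leftAdjointObjIsDefined_iff _).2 <|
        Functor.CorepresentableBy.isCorepresentable (X := A)
          { homEquiv := fun {A'} => Equiv.ofBijective _ (hbij A')
            homEquiv_comp := fun g f => R.map_comp f g }
    refine ⟨h, (isIso_iff_coyoneda_map_bijective _).2 fun A' => ?_⟩
    refine (Function.Bijective.of_comp_iff' (Equiv.bijective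
      (R.partialLeftAdjointHomEquiv (X := ⟨R.obj A, h⟩))) _).1 ?_
    exact (homEquiv_counit_comp h A').symm ▸ hbij A'

lemma IsIsoCounit.of_iso {R : 𝒜 ⥤ ℬ} {A B : 𝒜} (e : A ≅ B) (h : IsIsoCounit R A) :
    IsIsoCounit R B := by
  rw [isIsoCounit_iff_bijective_map] at h ⊢
  intro A'
  have map_eq : (fun g : B ⟶ A' => R.map g) =
      (R.mapIso e).homFromEquiv ∘ (fun g : A ⟶ A' => R.map g) ∘ e.symm.homFromEquiv := by
    funext g
    change R.map g = R.map e.inv ≫ R.map (e.hom ≫ g)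
    rw [← R.map_comp, e.inv_hom_id_assoc]
  rw [map_eq]
  exact (Equiv.bijective _).comp ((h A').comp (Equiv.bijective _))

/-- Here `hτ` says that `τ` is the mate of `σ` at `X`, so that `R'.map` and `R.map` correspond to
each other under the two adjunctions. -/
theorem IsIsoCounit.leftAdjoint_obj {Q : 𝒜 ⥤ ℬ} {U : ℬ ⥤ 𝒜} (adj : Q ⊣ U) {Q' : 𝒜' ⥤ ℬ'}
    {U' : ℬ' ⥤ 𝒜'} (adj' : Q' ⊣ U') {R : 𝒜 ⥤ 𝒜'} {R' : ℬ ⥤ ℬ'} (σ : U ⋙ R ≅ R' ⋙ U') {X : 𝒜}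
    (τ : Q'.obj (R.obj X) ≅ R'.obj (Q.obj X))
    (hτ : adj'.unit.app (R.obj X) ≫ U'.map τ.hom = R.map (adj.unit.app X) ≫ σ.hom.app (Q.obj X))
    (h : IsIsoCounit R X) : IsIsoCounit R' (Q.obj X) := by
  rw [isIsoCounit_iff_bijective_map] at h ⊢
  intro B
  let transpose : (R'.obj (Q.obj X) ⟶ R'.obj B) ≃ (R.obj X ⟶ R.obj (U.obj B)) :=
    (τ.homFromEquiv.symm.trans (adj'.homEquiv _ _)).trans (σ.app B).homToEquiv.symm
  have transpose_map : transpose ∘ (fun g : Q.obj X ⟶ B => R'.map g) =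
      (fun g => R.map g) ∘ adj.homEquiv X B := by
    funext g
    calc adj'.homEquiv _ _ (τ.hom ≫ R'.map g) ≫ σ.inv.app B
      _ = adj'.unit.app _ ≫ U'.map τ.hom ≫ (R' ⋙ U').map g ≫ σ.inv.app B := by
        simp [Adjunction.homEquiv_unit]
      _ = R.map (adj.unit.app X) ≫ (U ⋙ R).map g := by
        rw [reassoc_of% hτ, σ.inv.naturality, σ.hom_inv_id_app_assoc]
      _ = R.map (adj.homEquiv X B g) := by
        simp [Adjunction.homEquiv_unit]
  exact (Function.Bijective.of_comp_iff' transpose.bijective _).1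
    (transpose_map ▸ (h (U.obj B)).comp (Equiv.bijective _))

end Counit

/-! ### Linear quantization -/

section Quantization

variable {M : Type u} [Category.{v} M] [MonoidalCategory M] [SymmetricCategory M] [Preadditive M]
variable {C : Type v} [SmallCategory C] {perp : OrthogonalityRelation C}

lemma QFT.IsWConstant.of_iso {W : MorphismProperty C} {A B : QFT M perp} (e : A ≅ B)
    (hA : QFT.IsWConstant W A) : QFT.IsWConstant W B := fun _ _ f hf =>
  ((MorphismProperty.isomorphisms _).arrow_mk_iso_iff
    (Arrow.isoOfNatIso ((IsQFT M perp).ι.mapIso e) (Arrow.mk f))).1 (hA f hf)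

variable [MonoidalPreadditive M] [HasCountableColimits M]
  [∀ X : M, PreservesColimitsOfShape (Discrete ℕ) (tensorLeft X)]
  [∀ X : M, PreservesColimitsOfShape WalkingParallelPair (tensorLeft X)]

lemma commutes_envelope_map {V₁ V₂ V : ULie M} {f : V₁ ⟶ V} {g : V₂ ⟶ V}
    (h : (f.hom ⊗ₘ g.hom) ≫ V.bracket = 0) :
    Commutes ((envelope M).map f).hom ((envelope M).map g).hom := by
  have generators_commute : Commutes (f.hom ≫ envelopingAlgebra.incl V)
      (g.hom ≫ envelopingAlgebra.incl V) := by
    refine (commutes_iff_tensorHom_comp_commutator (A := .mk (envelopingAlgebra V))).2 ?_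
    rw [← tensorHom_comp_tensorHom_assoc, ← envelopingAlgebra.bracket_incl, reassoc_of% h,
      zero_comp]
  rw [← incl_envelope_map, ← incl_envelope_map] at generators_commute
  exact envelopingAlgebra.commutes_hom_of_incl generators_commute

lemma isQFT_comp_envelope (L : LFT M perp) : IsQFT M perp (L.obj ⋙ envelope M) :=
  fun _ _ _ f₁ f₂ h => commutes_iff_tensorHom_comp_commutator.1
    (commutes_envelope_map (L.property f₁ f₂ h))

variable (M perp) in
/-- The linear quantization functor, which applies the universal enveloping algebra functor
objectwise. -/
noncomputable def quantization : LFT M perp ⥤ QFT M perp :=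
  (IsQFT M perp).lift
    ((IsLFT M perp).ι ⋙ (Functor.whiskeringRight C _ _).obj (envelope M))
    isQFT_comp_envelope

variable (M perp) in
/-- Linear quantization is left adjoint to `Ulin`. -/
noncomputable def quantizationAdjunction : quantization M perp ⊣ Ulin M perp :=
  (Adjunction.whiskerRight C (envelopeAdjunction M)).restrictFullyFaithful
    (IsLFT M perp).fullyFaithfulι (IsQFT M perp).fullyFaithfulι (Iso.refl _) (Iso.refl _)

lemma quantizationAdjunction_unit_app_app (L : LFT M perp) (c : C) :
    ((quantizationAdjunction M perp).unit.app L).hom.app c =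
      (envelopeAdjunction M).unit.app (L.obj.obj c) := by
  have unit_eq := Adjunction.map_restrictFullyFaithful_unit_app (L := quantization M perp)
    (R := Ulin M perp) (Adjunction.whiskerRight C (envelopeAdjunction M))
    (IsLFT M perp).fullyFaithfulι (IsQFT M perp).fullyFaithfulι (Iso.refl _) (Iso.refl _) L
  refine (congr_app unit_eq c).trans ?_
  change ((Adjunction.whiskerRight C (envelopeAdjunction M)).unit.app L.obj).app c ≫
    (commutatorFunctor M).map (𝟙 _) ≫ 𝟙 _ = _
  rw [Adjunction.whiskerRight_unit_app_app]
  simp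

lemma quantization_isJLocal (P : ObjectProperty C) {L : LFT M perp} (hL : LFT.IsJLocal P L) :
    QFT.IsJLocal P ((quantization M perp).obj L) := by
  let σ : Ulin M perp ⋙ LFT.restrict M perp P ≅
      QFT.restrict M perp P ⋙ Ulin M (perp.restrict P) := Iso.refl _
  let τ : (quantization M (perp.restrict P)).obj ((LFT.restrict M perp P).obj L) ≅
      (QFT.restrict M perp P).obj ((quantization M perp).obj L) := Iso.refl _
  refine IsIsoCounit.leftAdjoint_obj (quantizationAdjunction M perp)
    (quantizationAdjunction M (perp.restrict P)) σ τ ?_ hL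
  apply ObjectProperty.hom_ext
  ext c : 2
  have restricted_unit : ((quantizationAdjunction M (perp.restrict P)).unit.app
      ((LFT.restrict M perp P).obj L)).hom.app c =
      ((quantizationAdjunction M perp).unit.app L).hom.app c.obj :=
    (quantizationAdjunction_unit_app_app _ c).trans
      (quantizationAdjunction_unit_app_app L c.obj).symm
  exact congrArg (· ≫ 𝟙 _) restricted_unit

lemma quantization_isWConstant {W : MorphismProperty C} {L : LFT M perp}
    (hL : LFT.IsWConstant W L) : QFT.IsWConstant W ((quantization M perp).obj L) := by
  intro c c' f hf
  have := hL f hf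
  exact inferInstanceAs (IsIso ((envelope M).map (L.obj.map f)))

end Quantization

end FieldTheory

theorem corollary5p4_general {M : Type u} [Category.{v} M] [MonoidalCategory M]
    [SymmetricCategory M] [Preadditive M] [MonoidalPreadditive M] [HasCountableColimits M]
    [∀ X : M, PreservesColimitsOfShape (Discrete ℕ) (tensorLeft X)]
    [∀ X : M, PreservesColimitsOfShape WalkingParallelPair (tensorLeft X)]
    {C : Type v} [SmallCategory C] (perp : FieldTheory.OrthogonalityRelation C) :
    (FieldTheory.Ulin M perp).IsRightAdjoint ∧
    ∀ (Qlin : FieldTheory.LFT M perp ⥤ FieldTheory.QFT M perp)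
      (_ : Qlin ⊣ FieldTheory.Ulin M perp),
      (∀ (P : ObjectProperty C) (L : FieldTheory.LFT M perp),
        FieldTheory.LFT.IsJLocal P L → FieldTheory.QFT.IsJLocal P (Qlin.obj L)) ∧
      (∀ (W : MorphismProperty C) (L : FieldTheory.LFT M perp),
        FieldTheory.LFT.IsWConstant W L → FieldTheory.QFT.IsWConstant W (Qlin.obj L)) := by
  refine ⟨(FieldTheory.quantizationAdjunction M perp).isRightAdjoint, fun Qlin adj => ?_⟩
  have e := (FieldTheory.quantizationAdjunction M perp).leftAdjointUniq adj
  exact ⟨fun P L hL => (FieldTheory.quantization_isJLocal P hL).of_iso (e.app L),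
    fun W L hL => (FieldTheory.quantization_isWConstant hL).of_iso (e.app L)⟩

theorem corollary5p4 {M : Type u} [Category.{v} M] [MonoidalCategory M] [SymmetricCategory M]
    [MonoidalClosed M] [HasLimits M] [HasColimits M] [Preadditive M]
    {C : Type v} [SmallCategory C] (perp : FieldTheory.OrthogonalityRelation C) :
    (FieldTheory.Ulin M perp).IsRightAdjoint ∧
    ∀ (Qlin : FieldTheory.LFT M perp ⥤ FieldTheory.QFT M perp)
      (_ : Qlin ⊣ FieldTheory.Ulin M perp),
      (∀ (P : ObjectProperty C) (L : FieldTheory.LFT M perp),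
        FieldTheory.LFT.IsJLocal P L → FieldTheory.QFT.IsJLocal P (Qlin.obj L)) ∧
      (∀ (W : MorphismProperty C) (L : FieldTheory.LFT M perp),
        FieldTheory.LFT.IsWConstant W L → FieldTheory.QFT.IsWConstant W (Qlin.obj L)) :=
  corollary5p4_general perp
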